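/- Let $G$ be a finite simple graph with vertex set $V$, and let $K$ be a field. Let $S=K[x_v : v\in V]$, and let $I(G)\subseteq S$ be the edge ideal of $G$, generated by the products $x_ix_j$ with $\{i,j\}$ an edge of $G$; equivalently, $I(G)$ is the Stanley–Reisner ideal of the independence complex $\Delta(G)$, whose faces are the independent sets of $G$. For an ideal $I\subseteq S$ and an ideal $J\subseteq S[\epsilon]$ ($\epsilon^2=0$), the algebra $S[\epsilon]/J$ is an infinitesimal deformation of $S/I$ if the canonical map $K[\epsilon]\to S[\epsilon]/J$ is flat and the image of $J$ under $S[\epsilon]\to S$, $\epsilon\mapsto 0$, is $I$; it is trivial if some $K$-algebra automorphism of $S[\epsilon]$ maps $J$ to $I\,S[\epsilon]$. The graph $G$ is called rigid (with respect to $K$) if every infinitesimal deformation of $S/I(G)$ is trivial. A vertex of $G$ is free if it has degree $1$; an edge is a leaf if it contains a free vertex; an edge $e$ is a branch if there is a leaf $e'\neq e$ with $e\cap e'\neq\emptyset$. The graph $G$ is chordal if every cycle of length at least $4$ has a chord, that is, an edge of $G$ joining two vertices of the cycle which is not an edge of the cycle. **Corollary.** Let $G$ be a finite chordal graph and $K$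 a field. Then $G$ is rigid with respect to $K$ if and only if each edge of $G$ is a branch and each vertex of a $3$-cycle of $G$ belongs to a leaf. -/

import Mathlib

open scoped DualNumber

noncomputable section

/-! ### Infinitesimal deformations and rigidity of quotient algebras -/

/-- For a homomorphism `f : R → A` of commutative rings and an ideal `J` of `A`: the composition
`R → A → A ⧸ J` is flat. -/
def IsFlatModulo {R A : Type*} [CommRing R] [CommRing A] (f : R →+* A) (J : Ideal A) : Prop :=
  ((Ideal.Quotient.mk J).comp f).Flat

section Deformation

variable (K : Type*) [Field K] {S : Type*} [CommRing S] [Algebra K S]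

/-- The canonical `K`-algebra homomorphism `K[ε] → S[ε]`, `a + b ε ↦ a + b ε`. -/
def dualNumberBaseMap (S : Type*) [CommRing S] [Algebra K S] : K[ε] →ₐ[K] S[ε] :=
  DualNumber.lift ⟨(Algebra.ofId K S[ε], ε), DualNumber.eps_mul_eps, fun _ => mul_comm _ _⟩

/-- For ideals `I` of `S` and `J` of `S[ε]`: the algebra `S[ε] ⧸ J` is an infinitesimal
deformation of `S ⧸ I`, i.e. `K[ε] → S[ε] ⧸ J` is flat and the reduction of `S[ε] ⧸ J`
modulo `ε` is `S ⧸ I` (the image of `J` under `S[ε] → S`, `ε ↦ 0`, is `I`). -/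
structure IsInfinitesimalDeformation (I : Ideal S) (J : Ideal S[ε]) : Prop where
  flat : IsFlatModulo (dualNumberBaseMap K S : K[ε] →+* S[ε]) J
  reduction : J.map (TrivSqZeroExt.fstHom K S S) = I

/-- The infinitesimal deformation `S[ε] ⧸ J` of `S ⧸ I` is trivial: some `K`-algebra
automorphism of `S[ε]` maps `J` to `I S[ε]`. -/
def IsTrivialDeformation (I : Ideal S) (J : Ideal S[ε]) : Prop :=
  ∃ σ : S[ε] ≃ₐ[K] S[ε], J.map σ = I.map (TrivSqZeroExt.inlHom S S)

/-- `S ⧸ I` is rigid over `K` if all its infinitesimal deformations are trivial. -/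
def IsRigidIdeal (I : Ideal S) : Prop :=
  ∀ J : Ideal S[ε], IsInfinitesimalDeformation K I J → IsTrivialDeformation K I J

end Deformation

/-! ### Stanley-Reisner ideals and independence complexes -/

/-- The Stanley-Reisner ideal in `K[x_v : v ∈ V]` of a simplicial complex on the vertex set `V`,
given by its set of faces: it is generated by the `x_N = ∏ i ∈ N, x_i` with `N` a non-face. -/
def stanleyReisnerIdeal (K : Type*) [Field K] {V : Type*} (Δ : Set (Finset V)) :
    Ideal (MvPolynomial V K) :=
  Ideal.span {m | ∃ N : Finset V, N ∉ Δ ∧ m = ∏ i ∈ N, MvPolynomial.X i}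

namespace SimpleGraph

variable {V : Type*} (G : SimpleGraph V)

/-- The independence complex `Δ(G)`: its faces are the independent sets of `G`. -/
def independenceComplex : Set (Finset V) :=
  {F | G.IsIndepSet (F : Set V)}

/-- The graph `G` is (algebraically) rigid with respect to the field `K`: the Stanley-Reisner ring
of its independence complex is rigid over `K`. -/
def IsAlgRigid (K : Type*) [Field K] : Prop :=
  IsRigidIdeal K (stanleyReisnerIdeal K G.independenceComplex)

/-- The edge ideal of `G`, generated by the `x_i x_j` with `{i, j}` an edge. -/
def edgeIdeal (K : Type*) [Field K] : Ideal (MvPolynomial V K) :=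
  Ideal.span {m | ∃ i j, G.Adj i j ∧ m = MvPolynomial.X i * MvPolynomial.X j}

theorem stanleyReisnerIdeal_independenceComplex (K : Type*) [Field K] :
    stanleyReisnerIdeal K G.independenceComplex = G.edgeIdeal K := by
  classical
  apply le_antisymm
  · refine Ideal.span_le.2 ?_
    rintro m ⟨N, hN, rfl⟩
    simp only [independenceComplex, Set.mem_ofPred_eq, IsIndepSet, Set.Pairwise, not_forall,
      not_not] at hN
    obtain ⟨i, hi, j, hj, hij, h⟩ := hN
    have hsub : ({i, j} : Finset V) ⊆ N := by
      intro x hx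
      simp only [Finset.mem_insert, Finset.mem_singleton] at hx
      rcases hx with rfl | rfl
      · exact hi
      · exact hj
    refine Ideal.mem_of_dvd _ (Finset.prod_dvd_prod_of_subset _ _ _ hsub) ?_
    rw [Finset.prod_pair hij]
    exact Ideal.subset_span ⟨i, j, h, rfl⟩
  · refine Ideal.span_le.2 ?_
    rintro m ⟨i, j, h, rfl⟩
    refine Ideal.subset_span ⟨{i, j}, ?_, ?_⟩
    · intro hF
      exact hF (by simp) (by simp) h.ne h
    · rw [Finset.prod_pair h.ne]

/-! ### Chordal graphs, leaves and branches -/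

/-- `G` is chordal: every cycle of length at least `4` has a chord, i.e. an edge of `G` that joins
two vertices of the cycle and is not an edge of the cycle. -/
def IsChordalGraph : Prop :=
  ∀ (v : V) (c : G.Walk v v), c.IsCycle → 4 ≤ c.length →
    ∃ i ∈ c.support, ∃ j ∈ c.support, G.Adj i j ∧ s(i, j) ∉ c.edges

/-- A free vertex: a vertex of degree one. -/
def IsFreeVertex (v : V) : Prop :=
  ∃! w, G.Adj v w

/-- A leaf: an edge with a free vertex. -/
def IsLeafEdge (e : Sym2 V) : Prop :=
  e ∈ G.edgeSet ∧ ∃ v ∈ e, G.IsFreeVertex v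

/-- A branch: an edge that shares a vertex with a leaf different from it. -/
def IsBranch (e : Sym2 V) : Prop :=
  e ∈ G.edgeSet ∧ ∃ e', G.IsLeafEdge e' ∧ e' ≠ e ∧ ∃ v, v ∈ e ∧ v ∈ e'

/-- `v` is a vertex of a cycle of length `3` of `G`. -/
def IsVertexOfThreeCycle (v : V) : Prop :=
  ∃ (u : V) (c : G.Walk u u), c.IsCycle ∧ c.length = 3 ∧ v ∈ c.support

end SimpleGraph

end

noncomputable section

/-! ### Flatness over the dual numbers -/

/-! Flatness over `K[ε]` means that the kernel of multiplication by `ε` equals its image. Hence a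
deformation `J` of `S ⧸ I` amounts to an `S`-linear map `I → S ⧸ I`, sending `f` to the class of any
`g` with `f + ε g ∈ J`. It is trivial if the map comes from a derivation of `S`; conversely, over a
domain a trivialising automorphism yields a map with the Leibniz rule, which is all that is used.

Rigid implies leaves. If `B` contains a neighbour of every vertex other than `i`, `j` that is
adjacent to `i` or `j`, then `x_i x_j ↦ ∏ b ∈ B, x_b`, with the other edges sent to `0`, is such a
map. Evaluation at the indicator point of an independent set, or along lines through it, shows that
it cannot come from a Leibniz map in two situations, which gives `exists_adj_not_dominated` and
`exists_not_adj_not_dominated`. In a chordal graph, dominating vertices outside the closed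
neighbourhood of `i` can be chosen independent (`exists_isIndepSet_dominating`), so missing pendant
vertices would produce these situations.

Leaves imply rigid, for any finite graph. Modulo the edge ideal only monomials with independent
support matter, and the equations `x_u d_v + x_v d_u = g_uv` are solved coefficient by coefficient.
Branches kill the coefficients divisible by neither variable; pendant vertices at triangles make the
prescribed coefficients of `d_u` consistent. -/

theorem DualNumber.flat_iff_eps_smul {K : Type*} [Field K] {M : Type*} [AddCommGroup M]
    [Module K[ε] M] :
    Module.Flat K[ε] M ↔ ∀ m : M, (ε : K[ε]) • m = 0 → ∃ m' : M, m = (ε : K[ε]) • m' := by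
  constructor
  · intro hM m hm
    -- The equational criterion writes `m` as a combination with coefficients killed by `ε`, hence
    -- divisible by `ε`.
    have h := Module.Flat.isTrivialRelation_of_sum_smul_eq_zero (R := K[ε]) (ι := Unit)
      (f := fun _ => ε) (x := fun _ => m) (by simpa using hm)
    obtain ⟨k, a, y, hx, ha⟩ := h
    have hdvd : ∀ j, ∃ c : K[ε], a () j = ε * c := by
      intro j
      have h1 : (ε : K[ε]) * a () j = 0 := by simpa using ha j
      have h2 : (a () j).fst = 0 := by
        simpa [DualNumber.snd_mul] using congrArg TrivSqZeroExt.snd h1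
      exact DualNumber.fst_eq_zero_iff_eps_dvd.1 h2
    choose c hc using hdvd
    refine ⟨∑ j, c j • y j, ?_⟩
    refine (hx ()).trans ?_
    rw [Finset.smul_sum]
    exact Finset.sum_congr rfl fun j _ => by rw [hc j, mul_smul]
  · intro h
    rw [Module.Flat.iff_rTensor_injective']
    intro I
    rw [injective_iff_map_eq_zero]
    rcases DualNumber.ideal_trichotomy I with rfl | rfl | rfl
    · intro x _
      exact Subsingleton.elim _ _
    · intro x hx
      have hε : (ε : K[ε]) ∈ Ideal.span {(ε : K[ε])} := Ideal.mem_span_singleton_self _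
      -- The ideal `(ε)` is principal, so every tensor is pure with left factor `ε`.
      have key : ∀ x : TensorProduct K[ε] (Ideal.span {(ε : K[ε])}) M,
          ∃ m : M, x = TensorProduct.tmul K[ε] ⟨ε, hε⟩ m := by
        intro x
        induction x using TensorProduct.induction_on with
        | zero => exact ⟨0, by simp⟩
        | tmul a m =>
          obtain ⟨a, ha⟩ := a
          obtain ⟨c, rfl⟩ := Ideal.mem_span_singleton'.1 ha
          refine ⟨c • m, ?_⟩
          rw [← TensorProduct.smul_tmul]
          rfl
        | add x y hx hy =>
          obtain ⟨m, rfl⟩ := hx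
          obtain ⟨m', rfl⟩ := hy
          exact ⟨m + m', (TensorProduct.tmul_add _ _ _).symm⟩
      obtain ⟨m, rfl⟩ := key x
      have h1 : (ε : K[ε]) • m = 0 := by
        have := congrArg (TensorProduct.lid K[ε] M) hx
        simpa using this
      obtain ⟨m', rfl⟩ := h m h1
      rw [← TensorProduct.smul_tmul]
      have : (ε : K[ε]) • (⟨ε, hε⟩ : Ideal.span {(ε : K[ε])}) = 0 :=
        Subtype.ext (DualNumber.eps_mul_eps)
      rw [this, TensorProduct.zero_tmul]
    · have : Function.Injective (LinearMap.rTensor M (⊤ : Ideal K[ε]).subtype) :=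
        (LinearEquiv.rTensor M (Submodule.topEquiv (R := K[ε]) (M := K[ε]))).injective
      exact (injective_iff_map_eq_zero _).1 this

theorem RingHom.flat_dualNumber_iff {K : Type*} [Field K] {A : Type*} [CommRing A]
    (g : K[ε] →+* A) : g.Flat ↔ ∀ a : A, g ε * a = 0 → ∃ b : A, a = g ε * b := by
  let := g.toAlgebra
  rw [RingHom.Flat, DualNumber.flat_iff_eps_smul]
  rfl

theorem dualNumberBaseMap_eps (K : Type*) [Field K] (S : Type*) [CommRing S] [Algebra K S] :
    dualNumberBaseMap K S ε = ε :=
  DualNumber.lift_apply_eps _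

theorem isFlatModulo_dualNumberBaseMap_iff (K : Type*) [Field K] {S : Type*} [CommRing S]
    [Algebra K S] (J : Ideal S[ε]) :
    IsFlatModulo (dualNumberBaseMap K S : K[ε] →+* S[ε]) J ↔
      ∀ x : S[ε], ε * x ∈ J → ∃ y : S[ε], x - ε * y ∈ J := by
  have hsmul : ∀ x : S[ε],
      ((Ideal.Quotient.mk J).comp (dualNumberBaseMap K S : K[ε] →+* S[ε])) ε *
        Ideal.Quotient.mk J x = Ideal.Quotient.mk J (ε * x) := by
    intro x
    rw [map_mul]
    congr 1
    exact congrArg (Ideal.Quotient.mk J) (dualNumberBaseMap_eps K S)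
  refine (RingHom.flat_dualNumber_iff _).trans ?_
  rw [Ideal.Quotient.mk_surjective.forall]
  refine forall_congr' fun x => ?_
  rw [hsmul, Ideal.Quotient.eq_zero_iff_mem, Ideal.Quotient.mk_surjective.exists]
  refine imp_congr_right fun _ => exists_congr fun y => ?_
  rw [hsmul, Ideal.Quotient.eq]

/-! ### First order deformations and derivations -/

section Deformation

variable {K : Type*} [Field K] {S : Type*} [CommRing S] [Algebra K S]

open TrivSqZeroExt (inl inr fst snd)

theorem dualNumber_eps_mul_eq_inr (x : S[ε]) : (ε : S[ε]) * x = inr x.fst := by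
  ext <;> simp

theorem mem_map_inlHom_iff (I : Ideal S) (z : S[ε]) :
    z ∈ I.map (TrivSqZeroExt.inlHom S S) ↔ z.fst ∈ I ∧ z.snd ∈ I := by
  constructor
  · intro hz
    induction hz using Submodule.span_induction with
    | mem x hx =>
      obtain ⟨f, hf, rfl⟩ := hx
      exact ⟨hf, I.zero_mem⟩
    | zero => exact ⟨I.zero_mem, I.zero_mem⟩
    | add x y _ _ hx hy => exact ⟨I.add_mem hx.1 hy.1, I.add_mem hx.2 hy.2⟩
    | smul a x _ hx =>
      refine ⟨I.mul_mem_left _ hx.1, ?_⟩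
      rw [smul_eq_mul, DualNumber.snd_mul]
      exact I.add_mem (I.mul_mem_left _ hx.2) (I.mul_mem_left _ hx.1)
  · rintro ⟨h1, h2⟩
    have : z = inl z.fst + ε * inl z.snd := by ext <;> simp
    rw [this]
    exact Ideal.add_mem _ (Ideal.mem_map_of_mem (TrivSqZeroExt.inlHom S S) h1)
      (Ideal.mul_mem_left _ _ (Ideal.mem_map_of_mem (TrivSqZeroExt.inlHom S S) h2))


namespace IsInfinitesimalDeformation

variable {I : Ideal S} {J : Ideal S[ε]}

theorem fst_mem (h : IsInfinitesimalDeformation K I J) {z : S[ε]} (hz : z ∈ J) : z.fst ∈ I := by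
  rw [← h.reduction]
  exact Ideal.mem_map_of_mem (TrivSqZeroExt.fstHom K S S) hz

theorem exists_lift (h : IsInfinitesimalDeformation K I J) {f : S} (hf : f ∈ I) :
    ∃ g : S, (inl f + inr g : S[ε]) ∈ J := by
  rw [← h.reduction, Ideal.mem_map_iff_of_surjective (TrivSqZeroExt.fstHom K S S)
    (TrivSqZeroExt.fst_surjective)] at hf
  obtain ⟨z, hz, rfl⟩ := hf
  refine ⟨z.snd, ?_⟩
  change inl z.fst + inr z.snd ∈ J
  rwa [TrivSqZeroExt.inl_fst_add_inr_snd_eq]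

/-- This is what flatness contributes: it makes the `ε`-part of a lift of `f ∈ I` unique modulo `I`.
-/
theorem inr_mem_iff (h : IsInfinitesimalDeformation K I J) {g : S} :
    (inr g : S[ε]) ∈ J ↔ g ∈ I := by
  constructor
  · intro hg
    obtain ⟨y, hy⟩ := (isFlatModulo_dualNumberBaseMap_iff K J).1 h.flat (inl g)
      (by simpa [dualNumber_eps_mul_eq_inr] using hg)
    simpa using h.fst_mem hy
  · intro hg
    obtain ⟨f, hf⟩ := h.exists_lift hg
    simpa [dualNumber_eps_mul_eq_inr] using J.mul_mem_left ε hf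

/-- By the Leibniz rule `z ↦ z + ε E z` is an algebra map, with inverse given by `-E`; the choice `E
= -D` straightens `J`. -/
theorem isTrivialDeformation_of_derivation (h : IsInfinitesimalDeformation K I J)
    (D : Derivation K S S) (hD : ∀ f ∈ I, (inl f + inr (D f) : S[ε]) ∈ J) :
    IsTrivialDeformation K I J := by
  let F : Derivation K S S → (S[ε] →ₐ[K] S[ε]) := fun E =>
    AlgHom.ofLinearMap
      { toFun := fun z => inl z.fst + inr (z.snd + E z.fst)
        map_add' := fun x y => by ext <;> simp <;> ring
        map_smul' := fun c x => by ext <;> simp }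
      (by ext <;> simp)
      (fun x y => by ext <;> simp; ring)
  have hF : ∀ E z, F E z = inl z.fst + inr (z.snd + E z.fst) := fun E z => rfl
  let σ : S[ε] ≃ₐ[K] S[ε] := AlgEquiv.ofAlgHom (F (-D)) (F D)
    (AlgHom.ext fun z => by ext <;> simp [hF]) (AlgHom.ext fun z => by ext <;> simp [hF])
  have hσ : ∀ z, σ z = inl z.fst + inr (z.snd - D z.fst) := fun z => by
    change F (-D) z = _
    rw [hF, sub_eq_add_neg]
    rfl
  have hσs : ∀ z, σ.symm z = inl z.fst + inr (z.snd + D z.fst) := fun z => rfl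
  refine ⟨σ, le_antisymm ?_ ?_⟩
  · refine Ideal.map_le_iff_le_comap.2 fun z hz => ?_
    have hz1 := h.fst_mem hz
    rw [Ideal.mem_comap, mem_map_inlHom_iff, hσ]
    refine ⟨by simpa using hz1, ?_⟩
    rw [← h.inr_mem_iff]
    have := J.sub_mem hz (hD _ hz1)
    convert this using 1
    ext <;> simp
  · intro z hz
    rw [mem_map_inlHom_iff] at hz
    have : z = σ (σ.symm z) := (σ.apply_symm_apply z).symm
    rw [this]
    refine Ideal.mem_map_of_mem σ ?_
    rw [hσs]
    have h2 := J.add_mem (hD _ hz.1) (h.inr_mem_iff.2 hz.2)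
    convert h2 using 1
    ext <;> simp [add_comm]

end IsInfinitesimalDeformation

/-- The first order deformation given by an additive map that is linear on `I` modulo `I`. -/
def deformationIdeal (I : Ideal S) (ψ : S →+ S)
    (hψ : ∀ p, ∀ f ∈ I, ψ (p * f) - p * ψ f ∈ I) : Ideal S[ε] where
  carrier := {z | z.fst ∈ I ∧ z.snd - ψ z.fst ∈ I}
  zero_mem' := by simp
  add_mem' := by
    rintro x y ⟨hx1, hx2⟩ ⟨hy1, hy2⟩
    refine ⟨I.add_mem hx1 hy1, ?_⟩
    have := I.add_mem hx2 hy2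
    simp only [TrivSqZeroExt.snd_add, TrivSqZeroExt.fst_add, map_add]
    convert this using 1
    ring
  smul_mem' := by
    rintro a x ⟨hx1, hx2⟩
    refine ⟨I.mul_mem_left _ hx1, ?_⟩
    have h1 := I.mul_mem_left a.fst hx2
    have h2 := hψ a.fst _ hx1
    have h3 := I.mul_mem_left a.snd hx1
    simp only [smul_eq_mul, DualNumber.snd_mul, TrivSqZeroExt.fst_mul]
    convert I.add_mem (I.sub_mem h1 h2) h3 using 1
    ring

theorem isInfinitesimalDeformation_deformationIdeal (I : Ideal S) (ψ : S →+ S)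
    (hψ : ∀ p, ∀ f ∈ I, ψ (p * f) - p * ψ f ∈ I) :
    IsInfinitesimalDeformation K I (deformationIdeal I ψ hψ) where
  flat := by
    rw [isFlatModulo_dualNumberBaseMap_iff]
    intro x hx
    have hx1 : x.fst ∈ I := by
      have := hx.2
      simpa [dualNumber_eps_mul_eq_inr] using this
    -- With this witness, `x - ε y` is the standard lift `x.fst + ε ψ(x.fst)`.
    refine ⟨inl (x.snd - ψ x.fst), ?_, ?_⟩
    · simpa [dualNumber_eps_mul_eq_inr] using hx1
    · simp [dualNumber_eps_mul_eq_inr]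
  reduction := by
    apply le_antisymm
    · exact Ideal.map_le_iff_le_comap.2 fun z hz => hz.1
    · intro f hf
      have : (inl f + inr (ψ f) : S[ε]) ∈ deformationIdeal I ψ hψ :=
        ⟨by simpa using hf, by simp⟩
      simpa using Ideal.mem_map_of_mem (TrivSqZeroExt.fstHom K S S) this

/-- The automorphism `σ` need neither fix `ε` nor reduce to the identity on `S`. Its reduction is
undone by `T`, and the factor by which it scales `ε` by the unit `u`. -/
theorem IsTrivialDeformation.exists_leibniz [IsDomain S] {I : Ideal S} {J : Ideal S[ε]}
    (h : IsInfinitesimalDeformation K I J) (hJ : IsTrivialDeformation K I J) :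
    ∃ D : S → S, (∀ a b, D (a * b) = a * D b + b * D a) ∧
      ∀ f g : S, (inl f + inr g : S[ε]) ∈ J → D f - g ∈ I := by
  obtain ⟨σ, hσ⟩ := hJ
  have hmem : ∀ z, z ∈ J → (σ z).fst ∈ I ∧ (σ z).snd ∈ I := fun z hz => by
    rw [← mem_map_inlHom_iff, ← hσ]
    exact Ideal.mem_map_of_mem σ hz
  have hsymm : ∀ f ∈ I, (σ.symm (inl f)).fst ∈ I := by
    intro f hf
    have h1 : (inl f : S[ε]) ∈ J.map σ := by
      rw [hσ]
      exact Ideal.mem_map_of_mem (TrivSqZeroExt.inlHom S S) hf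
    rw [Ideal.mem_map_iff_of_surjective σ σ.surjective] at h1
    obtain ⟨z, hz, hz'⟩ := h1
    rw [← hz', σ.symm_apply_apply]
    exact h.fst_mem hz
  -- The reduction of `τ ε` squares to zero in a domain.
  have heps : ∀ τ : S[ε] ≃ₐ[K] S[ε], (τ ε).fst = 0 := by
    intro τ
    have h1 : τ ε * τ ε = 0 := by rw [← map_mul, DualNumber.eps_mul_eps, map_zero]
    simpa using congrArg fst h1
  have hinr : ∀ (τ : S[ε] ≃ₐ[K] S[ε]) (s : S),
      τ (inr s) = inr ((τ ε).snd * (τ (inl s)).fst) := by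
    intro τ s
    have : (inr s : S[ε]) = ε * inl s := by simp [dualNumber_eps_mul_eq_inr]
    rw [this, map_mul]
    ext <;> simp [heps]
  have hinv : ∀ s : S, (σ.symm (inl (σ (inl s)).fst)).fst = s := by
    intro s
    have h1 : (inl (σ (inl s)).fst : S[ε]) = σ (inl s) - inr (σ (inl s)).snd := by
      ext <;> simp
    rw [h1, map_sub, σ.symm_apply_apply, hinr]
    simp
  have hunit : ∃ u : S, u * (σ.symm (inl (σ ε).snd)).fst = 1 := by
    refine ⟨(σ.symm ε).snd, ?_⟩
    have h1 : σ ε = inr (σ ε).snd := by ext <;> simp [heps]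
    have h2 : σ.symm (σ ε) = ε := σ.symm_apply_apply _
    rw [h1, hinr] at h2
    simpa using congrArg snd h2
  obtain ⟨u, hu⟩ := hunit
  let T : S →+* S := (TrivSqZeroExt.fstHom K S S : S[ε] →+* S).comp
    ((σ.symm : S[ε] →+* S[ε]).comp (TrivSqZeroExt.inlHom S S))
  have hT : ∀ s, T s = (σ.symm (inl s)).fst := fun s => rfl
  refine ⟨fun f => -(u * T (σ (inl f)).snd), ?_, ?_⟩
  · intro a b
    have h1 : T (σ (inl (a * b))).snd = a * T (σ (inl b)).snd + b * T (σ (inl a)).snd := by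
      rw [TrivSqZeroExt.inl_mul, map_mul, DualNumber.snd_mul, map_add, map_mul, map_mul,
        hT (σ (inl a)).fst, hT (σ (inl b)).fst, hinv, hinv]
      ring
    simp only [h1]
    ring
  · intro f g hfg
    have h1 := (hmem _ hfg).2
    have h2 := hsymm _ h1
    -- The `ε`-part of `σ (f + ε g)` lies in `I`, and `T` preserves `I`; multiplication by `-u` then
    -- isolates `D f - g`.
    rw [map_add, hinr, ← hT, TrivSqZeroExt.snd_add, TrivSqZeroExt.snd_inr, map_add, map_mul,
      hT (σ (inl g)).fst, hinv, hT (σ ε).snd] at h2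
    have h3 := I.mul_mem_left (-u) h2
    convert h3 using 1
    linear_combination g * hu

theorem IsRigidIdeal.exists_leibniz [IsDomain S] {I : Ideal S} (h : IsRigidIdeal K I)
    (ψ : S →+ S) (hψ : ∀ p, ∀ f ∈ I, ψ (p * f) - p * ψ f ∈ I) :
    ∃ D : S → S, (∀ a b, D (a * b) = a * D b + b * D a) ∧ ∀ f ∈ I, D f - ψ f ∈ I := by
  have h1 := isInfinitesimalDeformation_deformationIdeal (K := K) I ψ hψ
  obtain ⟨D, hD, hD'⟩ := (h _ h1).exists_leibniz h1
  exact ⟨D, hD, fun f hf => hD' f (ψ f) ⟨by simpa using hf, by simp⟩⟩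

end Deformation

/-! ### Nontrivial deformations of edge ideals -/

namespace MvPolynomial

theorem X_mul_divMonomial_of_ne {σ R : Type*} [CommSemiring R] {u i : σ} (h : u ≠ i)
    (f : MvPolynomial σ R) :
    (X u * f).divMonomial (Finsupp.single i 1) = X u * f.divMonomial (Finsupp.single i 1) := by
  classical
  ext m
  rw [coeff_divMonomial, coeff_X_mul', coeff_X_mul', coeff_divMonomial]
  have hu : u ∈ (Finsupp.single i 1 + m).support ↔ u ∈ m.support := by
    simp [Finsupp.single_eq_of_ne h]
  simp only [hu]
  split_ifs with hm
  · congr 1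
    ext w
    rw [Finsupp.mem_support_iff] at hm
    by_cases hw : u = w
    · subst hw
      simp [Finsupp.single_eq_of_ne h]
    · simp [Finsupp.single_eq_of_ne (Ne.symm hw)]
  · rfl

end MvPolynomial

/-- Linearity modulo `I` only has to be checked on multiples of generators; the induction needs all
`p` at once. -/
theorem sub_mem_of_mem_span {S : Type*} [CommRing S] {s : Set S} {I : Ideal S}
    (hI : I = Ideal.span s) (ψ : S →+ S) (h : ∀ e ∈ s, ∃ c, ∀ g, ψ (g * e) - g * c ∈ I)
    (p f : S) (hf : f ∈ I) : ψ (p * f) - p * ψ f ∈ I := by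
  rw [hI] at hf
  induction hf using Submodule.span_induction generalizing p with
  | mem e he =>
    obtain ⟨c, hc⟩ := h e he
    have h1 := hc p
    have h2 := I.mul_mem_left p (hc 1)
    rw [one_mul, one_mul] at h2
    convert I.sub_mem h1 h2 using 1
    ring
  | zero => simp
  | add x y _ _ hx hy =>
    have := I.add_mem (hx p) (hy p)
    rw [mul_add, map_add, map_add]
    convert this using 1
    ring
  | smul a x _ hx =>
    have h1 := hx (p * a)
    have h2 := I.mul_mem_left p (hx a)
    rw [smul_eq_mul, ← mul_assoc]
    convert I.sub_mem h1 h2 using 1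
    ring

namespace SimpleGraph

variable {V : Type*} {G : SimpleGraph V} {K : Type*} [Field K]

open MvPolynomial

theorem X_mul_X_mem_edgeIdeal {u v : V} (h : G.Adj u v) :
    (X u * X v : MvPolynomial V K) ∈ G.edgeIdeal K :=
  Ideal.subset_span ⟨u, v, h, rfl⟩

theorem prod_X_mul_X_mem_edgeIdeal {B : Finset V} {v : V} (h : ∃ b ∈ B, G.Adj b v) :
    ((∏ b ∈ B, X b) * X v : MvPolynomial V K) ∈ G.edgeIdeal K := by
  obtain ⟨b, hb, hv⟩ := h
  exact Ideal.mem_of_dvd _ (mul_dvd_mul_right (Finset.dvd_prod_of_mem _ hb) _)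
    (X_mul_X_mem_edgeIdeal hv)

theorem aeval_eq_zero_of_mem_edgeIdeal {A : Type*} [CommRing A] [Algebra K A] {t : V → A}
    (ht : ∀ u v, G.Adj u v → t u * t v = 0) {f : MvPolynomial V K} (hf : f ∈ G.edgeIdeal K) :
    aeval t f = 0 := by
  have h : G.edgeIdeal K ≤ RingHom.ker (aeval t : MvPolynomial V K →ₐ[K] A) := by
    refine Ideal.span_le.2 ?_
    rintro _ ⟨u, v, huv, rfl⟩
    simpa [RingHom.mem_ker] using ht u v huv
  exact h hf

/-- The quotient by the monomial `x_i x_j` (dropping the terms it does not divide), multiplied by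
`∏ b ∈ B, x_b`. -/
def edgeQuotient (K : Type*) [Field K] (i j : V) (B : Finset V) :
    MvPolynomial V K →+ MvPolynomial V K :=
  AddMonoidHom.mk' (fun f => (∏ b ∈ B, X b) *
      (f.divMonomial (Finsupp.single i 1)).divMonomial (Finsupp.single j 1))
    fun f g => by rw [add_divMonomial, add_divMonomial, mul_add]

theorem edgeQuotient_apply (i j : V) (B : Finset V) (f : MvPolynomial V K) :
    edgeQuotient K i j B f = (∏ b ∈ B, X b) *
      (f.divMonomial (Finsupp.single i 1)).divMonomial (Finsupp.single j 1) := rfl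

theorem edgeQuotient_self {i j : V} (B : Finset V) (g : MvPolynomial V K) :
    edgeQuotient K i j B (X i * X j * g) = (∏ b ∈ B, X b) * g := by
  rw [edgeQuotient_apply, mul_assoc, X_mul_divMonomial, X_mul_divMonomial]

theorem edgeQuotient_left_mem {i j v : V} {B : Finset V} (hv : v ≠ j) (g : MvPolynomial V K)
    (h : ∃ b ∈ B, G.Adj b v) : edgeQuotient K i j B (X i * X v * g) ∈ G.edgeIdeal K := by
  rw [edgeQuotient_apply, mul_assoc, X_mul_divMonomial, X_mul_divMonomial_of_ne hv, ← mul_assoc]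
  exact Ideal.mul_mem_right _ _ (prod_X_mul_X_mem_edgeIdeal h)

theorem edgeQuotient_right_mem {i j v : V} {B : Finset V} (hij : i ≠ j) (hv : v ≠ i)
    (g : MvPolynomial V K) (h : ∃ b ∈ B, G.Adj b v) :
    edgeQuotient K i j B (X j * X v * g) ∈ G.edgeIdeal K := by
  rw [edgeQuotient_apply, mul_assoc, X_mul_divMonomial_of_ne hij.symm,
    X_mul_divMonomial_of_ne hv, X_mul_divMonomial, ← mul_assoc]
  exact Ideal.mul_mem_right _ _ (prod_X_mul_X_mem_edgeIdeal h)

/-- An edge disjoint from `{i, j}` survives the division. An edge meeting it in one vertex leaves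
its other end `v` as a factor, and `B` supplies a neighbour of `v`. -/
theorem edgeQuotient_mem {i j : V} {B : Finset V} (hij : i ≠ j)
    (hi : ∀ v, G.Adj i v → v ≠ j → ∃ b ∈ B, G.Adj b v)
    (hj : ∀ v, G.Adj j v → v ≠ i → ∃ b ∈ B, G.Adj b v) {u v : V} (huv : G.Adj u v)
    (hne : s(u, v) ≠ s(i, j)) (g : MvPolynomial V K) :
    edgeQuotient K i j B (X u * X v * g) ∈ G.edgeIdeal K := by
  have hne1 : ¬ (u = i ∧ v = j) := by rintro ⟨rfl, rfl⟩; exact hne rfl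
  have hne2 : ¬ (u = j ∧ v = i) := by rintro ⟨rfl, rfl⟩; exact hne Sym2.eq_swap
  by_cases hui : u = i
  · subst hui
    exact edgeQuotient_left_mem (by tauto) g (hi v huv (by tauto))
  by_cases hvi : v = i
  · subst hvi
    rw [mul_comm (X u)]
    exact edgeQuotient_left_mem (by tauto) g (hi u huv.symm (by tauto))
  by_cases huj : u = j
  · subst huj
    exact edgeQuotient_right_mem hij hvi g (hj v huv hvi)
  by_cases hvj : v = j
  · subst hvj
    rw [mul_comm (X u)]
    exact edgeQuotient_right_mem hij hui g (hj u huv.symm hui)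
  rw [edgeQuotient_apply, mul_assoc, X_mul_divMonomial_of_ne hui, X_mul_divMonomial_of_ne hvi,
    X_mul_divMonomial_of_ne huj, X_mul_divMonomial_of_ne hvj, ← mul_assoc (X u)]
  exact Ideal.mul_mem_left _ _ (Ideal.mul_mem_right _ _ (X_mul_X_mem_edgeIdeal huv))

theorem IsAlgRigid.exists_leibniz (h : G.IsAlgRigid K) {i j : V} {B : Finset V}
    (hij : G.Adj i j) (hi : ∀ v, G.Adj i v → v ≠ j → ∃ b ∈ B, G.Adj b v)
    (hj : ∀ v, G.Adj j v → v ≠ i → ∃ b ∈ B, G.Adj b v) :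
    ∃ D : MvPolynomial V K → MvPolynomial V K, (∀ a b, D (a * b) = a * D b + b * D a) ∧
      D (X i * X j) - ∏ b ∈ B, X b ∈ G.edgeIdeal K ∧
      ∀ u v, G.Adj u v → s(u, v) ≠ s(i, j) → D (X u * X v) ∈ G.edgeIdeal K := by
  have hr : IsRigidIdeal K (G.edgeIdeal K) := by
    rw [← stanleyReisnerIdeal_independenceComplex]
    exact h
  obtain ⟨D, hD, hD'⟩ := hr.exists_leibniz (edgeQuotient K i j B)
    (sub_mem_of_mem_span rfl _ (by
      rintro _ ⟨u, v, huv, rfl⟩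
      by_cases hne : s(u, v) = s(i, j)
      · refine ⟨∏ b ∈ B, X b, fun g => ?_⟩
        have : (X u * X v : MvPolynomial V K) = X i * X j := by
          rcases Sym2.eq_iff.1 hne with ⟨rfl, rfl⟩ | ⟨rfl, rfl⟩
          · rfl
          · exact mul_comm _ _
        rw [this, mul_comm g, edgeQuotient_self, mul_comm g, sub_self]
        exact Ideal.zero_mem _
      · refine ⟨0, fun g => ?_⟩
        rw [mul_zero, sub_zero, mul_comm g]
        exact edgeQuotient_mem hij.ne hi hj huv hne g))
  refine ⟨D, hD, ?_, fun u v huv hne => ?_⟩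
  · have h1 := hD' _ (X_mul_X_mem_edgeIdeal hij)
    have h2 := edgeQuotient_self (K := K) (i := i) (j := j) B 1
    rw [mul_one, mul_one] at h2
    rwa [h2] at h1
  · have h1 := hD' _ (X_mul_X_mem_edgeIdeal huv)
    have h2 := edgeQuotient_mem (K := K) hij.ne hi hj huv hne 1
    rw [mul_one] at h2
    simpa using Ideal.add_mem _ h1 h2

/-- In a rigid graph, no edge becomes isolated after removing the closed neighbourhood of an
independent set. -/
theorem IsAlgRigid.exists_adj_not_dominated (h : G.IsAlgRigid K) {i j : V} {A : Finset V}
    (hij : G.Adj i j) (hA : G.IsIndepSet (A : Set V)) (hAi : ∀ a ∈ A, ¬ G.Adj a i)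
    (hAj : ∀ a ∈ A, ¬ G.Adj a j) :
    (∃ v, G.Adj i v ∧ v ≠ j ∧ ∀ a ∈ A, ¬ G.Adj a v) ∨
      ∃ v, G.Adj j v ∧ v ≠ i ∧ ∀ a ∈ A, ¬ G.Adj a v := by
  classical
  by_contra! hcon
  obtain ⟨D, hD, hD1, -⟩ := h.exists_leibniz hij hcon.1 hcon.2
  have hi : i ∉ A := fun hi => hAj i hi hij
  have hj : j ∉ A := fun hj => hAi j hj hij.symm
  -- At the indicator point of `A`, a zero of the edge ideal, `x_i` and `x_j` vanish while `∏ a ∈ A,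
  -- x_a` is `1`.
  have h1 := aeval_eq_zero_of_mem_edgeIdeal (A := K) (t := fun v => if v ∈ A then 1 else 0)
    (fun u v huv => by
      by_cases hu : u ∈ A
      · have hv : v ∉ A := fun hv => hA hu hv huv.ne huv
        simp [hv]
      · simp [hu]) hD1
  rw [hD, map_sub, map_add, map_mul, map_mul, aeval_X, aeval_X, map_prod,
    Finset.prod_congr rfl (g := fun _ => 1) fun b hb => by simp [hb]] at h1
  simp [hi, hj] at h1

/-- In a rigid graph, after removing the closed neighbourhood of an independent set, no vertex
in the neighbourhood of a vertex `i` is adjacent to all the other ones. -/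
theorem IsAlgRigid.exists_not_adj_not_dominated (h : G.IsAlgRigid K) {i j k : V} {A : Finset V}
    (hij : G.Adj i j) (hik : G.Adj i k) (hjk : k ≠ j) (hA : G.IsIndepSet (A : Set V))
    (hAi : ∀ a ∈ A, ¬ G.Adj a i) (hAj : ∀ a ∈ A, ¬ G.Adj a j) (hAk : ∀ a ∈ A, ¬ G.Adj a k) :
    ∃ v, G.Adj i v ∧ v ≠ j ∧ ¬ G.Adj j v ∧ ∀ a ∈ A, ¬ G.Adj a v := by
  classical
  by_contra! hcon
  have hi : i ∉ A := fun hi => hAj i hi hij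
  have hj : j ∉ A := fun hj => hAi j hj hij.symm
  have hk : k ∉ A := fun hk => hAi k hk hik.symm
  -- The vertex `j` itself dominates its own neighbours, so `B = A ∪ {j}` is admissible.
  obtain ⟨D, hD, hD1, hD2⟩ := h.exists_leibniz (B := insert j A) hij
    (fun v hv hvj => by
      by_cases hjv : G.Adj j v
      · exact ⟨j, by simp, hjv⟩
      · obtain ⟨a, ha, hav⟩ := hcon v hv hvj hjv
        exact ⟨a, by simp [ha], hav⟩)
    (fun v hv _ => ⟨j, by simp, hv⟩)
  have hD3 := hD2 i k hik (fun he => by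
    rcases Sym2.eq_iff.1 he with ⟨-, rfl⟩ | ⟨rfl, rfl⟩
    · exact hjk rfl
    · exact hij.ne rfl)
  -- `t w` is the line through the indicator point of `A` in direction `w`. Along `t j` the value of
  -- `D x_i` is `1`, along `t k` it is `0`; the lines meet at parameter `0`.
  let t : V → V → Polynomial K := fun w v => if v ∈ A then 1 else if v = w then Polynomial.X else 0
  have ht : ∀ w, (∀ a ∈ A, ¬ G.Adj a w) → ∀ u v, G.Adj u v → t w u * t w v = 0 := by
    intro w hw u v huv
    by_cases hu : u ∈ A
    · have hv : v ∉ A := fun hv => hA hu hv huv.ne huv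
      have hvw : v ≠ w := by rintro rfl; exact hw u hu huv
      simp [t, hv, hvw]
    · by_cases huw : u = w
      · subst huw
        have hv : v ∉ A := fun hv => hw v hv huv.symm
        simp [t, hv, huv.ne.symm]
      · simp [t, hu, huw]
  have hev : ∀ (w : V) (f : MvPolynomial V K), (aeval (t w) f).eval 0 =
      aeval (fun v => if v ∈ A then (1 : K) else 0) f := by
    intro w f
    have : (Polynomial.aeval (0 : K)).comp (aeval (t w)) =
        (aeval (fun v => if v ∈ A then (1 : K) else 0) : MvPolynomial V K →ₐ[K] K) := by
      refine MvPolynomial.algHom_ext fun v => ?_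
      by_cases hv : v ∈ A
      · simp [t, hv]
      · by_cases hvw : v = w
        · subst hvw
          simp [t, hv]
        · simp [t, hv, hvw]
    simpa [Polynomial.aeval_def] using! congrArg (fun φ => φ f) this
  have h1 := aeval_eq_zero_of_mem_edgeIdeal (ht j hAj) hD1
  have h2 := aeval_eq_zero_of_mem_edgeIdeal (ht k hAk) hD3
  rw [hD, Finset.prod_insert hj, map_sub, map_add, map_mul, map_mul, map_mul, aeval_X, aeval_X,
    map_prod, Finset.prod_congr rfl (g := fun _ => 1) fun b hb => by simp [t, hb]] at h1
  rw [hD, map_add, map_mul, map_mul, aeval_X, aeval_X] at h2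
  have h3 : aeval (t j) (D (X i)) = 1 := by
    have h4 : (Polynomial.X : Polynomial K) * (aeval (t j) (D (X i)) - 1) = 0 := by
      have : i ≠ j := hij.ne
      simpa [t, hi, hj, this, mul_sub] using h1
    rcases mul_eq_zero.1 h4 with h5 | h5
    · exact absurd h5 Polynomial.X_ne_zero
    · exact sub_eq_zero.1 h5
  have h4 : aeval (t k) (D (X i)) = 0 := by
    have : i ≠ k := hik.ne
    simpa [t, hi, hk, this] using h2
  have h5 := hev j (D (X i))
  have h6 := hev k (D (X i))
  rw [h3] at h5
  rw [h4] at h6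
  simp only [Polynomial.eval_one, Polynomial.eval_zero] at h5 h6
  exact one_ne_zero (h5.trans h6.symm)

end SimpleGraph

/-! ### Chordal rigid graphs -/

namespace SimpleGraph

variable {V : Type*} {G : SimpleGraph V}

/-- `l` is a free vertex whose only neighbour is `i`. -/
def IsPendantAt (G : SimpleGraph V) (i l : V) : Prop :=
  G.Adj i l ∧ ∀ u, G.Adj l u → u = i

theorem IsPendantAt.isLeafEdge {i l : V} (h : G.IsPendantAt i l) : G.IsLeafEdge s(i, l) :=
  ⟨h.1, l, by simp, i, h.1.symm, h.2⟩

theorem IsLeafEdge.eq_or_isPendantAt {e : Sym2 V} (he : G.IsLeafEdge e) {v : V} (hv : v ∈ e) :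
    ∃ w, e = s(v, w) ∧ G.Adj v w ∧ (G.IsPendantAt v w ∨ ∀ u, G.Adj v u → u = w) := by
  obtain ⟨w, rfl⟩ := hv
  obtain ⟨hvw, x, hx, hfree⟩ := he
  refine ⟨w, rfl, hvw, ?_⟩
  rw [mem_edgeSet] at hvw
  rcases Sym2.mem_iff.1 hx with rfl | rfl
  · exact Or.inr fun u hu => hfree.unique hu hvw
  · exact Or.inl ⟨hvw, fun u hu => hfree.unique hu hvw.symm⟩

/-- If the common vertex were the free end of the leaf, the leaf would coincide with the edge; so
the free vertex is the far end. -/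
theorem isBranch_iff {i j : V} : G.IsBranch s(i, j) ↔ G.Adj i j ∧
    ((∃ l, l ≠ j ∧ G.IsPendantAt i l) ∨ ∃ l, l ≠ i ∧ G.IsPendantAt j l) := by
  constructor
  · rintro ⟨hij, e, he, hne, v, hv, hve⟩
    rw [mem_edgeSet] at hij
    refine ⟨hij, ?_⟩
    obtain ⟨w, rfl, hvw, hw⟩ := he.eq_or_isPendantAt hve
    rcases Sym2.mem_iff.1 hv with rfl | rfl
    · have hwj : w ≠ j := by rintro rfl; exact hne rfl
      rcases hw with hw | hw
      · exact Or.inl ⟨w, hwj, hw⟩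
      · exact absurd (hw j hij).symm hwj
    · have hwi : w ≠ i := by rintro rfl; exact hne Sym2.eq_swap
      rcases hw with hw | hw
      · exact Or.inr ⟨w, hwi, hw⟩
      · exact absurd (hw i hij.symm).symm hwi
  · rintro ⟨hij, ⟨l, hl, h⟩ | ⟨l, hl, h⟩⟩
    · refine ⟨hij, _, h.isLeafEdge, fun he => hl ?_, i, by simp, by simp⟩
      rcases Sym2.eq_iff.1 he with ⟨-, h2⟩ | ⟨h1, h2⟩
      · exact h2
      · exact absurd h1 hij.ne
    · refine ⟨hij, _, h.isLeafEdge, fun he => hl ?_, j, by simp, by simp⟩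
      rcases Sym2.eq_iff.1 he with ⟨h1, h2⟩ | ⟨-, h2⟩
      · exact absurd h1 hij.symm.ne
      · exact h2

theorem isVertexOfThreeCycle_iff {v : V} :
    G.IsVertexOfThreeCycle v ↔ ∃ j k, G.Adj v j ∧ G.Adj v k ∧ G.Adj j k := by
  constructor
  · rintro ⟨u, c, -, hlen, hv⟩
    match c, hlen with
    | .cons (v := a) h1 (.cons (v := b) h2 (.cons h3 .nil)), _ =>
      simp only [Walk.support_cons, Walk.support_nil, List.mem_cons, List.not_mem_nil,
        or_false] at hv
      rcases hv with rfl | rfl | rfl | rfl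
      · exact ⟨a, b, h1, h3.symm, h2⟩
      · exact ⟨u, b, h1.symm, h2, h3.symm⟩
      · exact ⟨u, a, h3, h2.symm, h1⟩
      · exact ⟨a, b, h1, h3.symm, h2⟩
  · rintro ⟨j, k, hj, hk, hjk⟩
    refine ⟨v, .cons hj (.cons hjk (.cons hk.symm .nil)), ?_, rfl, by simp⟩
    have := hj.ne
    have := hk.ne
    have := hjk.ne
    simp [Walk.isCycle_def, Walk.isTrail_def, *, Ne.symm, Ne.symm hj.ne, Ne.symm hk.ne]

theorem exists_isLeafEdge_iff {i j k : V} (hij : G.Adj i j) (hik : G.Adj i k) (hjk : j ≠ k) :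
    (∃ e, G.IsLeafEdge e ∧ i ∈ e) ↔ ∃ l, G.IsPendantAt i l := by
  constructor
  · rintro ⟨e, he, hi⟩
    obtain ⟨w, rfl, hvw, hw | hw⟩ := he.eq_or_isPendantAt hi
    · exact ⟨w, hw⟩
    · exact absurd ((hw j hij).trans (hw k hik).symm) hjk
  · rintro ⟨l, hl⟩
    exact ⟨_, hl.isLeafEdge, by simp⟩

/-! ### Short cycles and domination in chordal graphs -/

namespace IsChordalGraph

theorem adj_of_four_cycle (hG : G.IsChordalGraph) {a b c d : V} (hab : G.Adj a b)
    (hbc : G.Adj b c) (hcd : G.Adj c d) (hda : G.Adj d a) (hac : a ≠ c) (hbd : b ≠ d) :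
    G.Adj a c ∨ G.Adj b d := by
  by_contra! hcon
  have hab' := hab.ne
  have hbc' := hbc.ne
  have hcd' := hcd.ne
  have hda' := hda.ne
  obtain ⟨i, hi, j, hj, hij, he⟩ := hG a (.cons hab (.cons hbc (.cons hcd (.cons hda .nil))))
    (by simp [Walk.isCycle_def, Walk.isTrail_def]; grind) (by simp)
  have hij' := hij.symm
  have hne := hij.ne
  simp only [Walk.support_cons, Walk.support_nil, List.mem_cons, List.not_mem_nil, or_false,
    Walk.edges_cons, Walk.edges_nil, not_or,
    Sym2.eq_iff] at hi hj he
  grind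

theorem false_of_five_cycle (hG : G.IsChordalGraph) {a b c d e : V} (hab : G.Adj a b)
    (hbc : G.Adj b c) (hcd : G.Adj c d) (hde : G.Adj d e) (hea : G.Adj e a)
    (hac : a ≠ c) (had : a ≠ d) (hbd : b ≠ d) (hbe : b ≠ e) (hce : c ≠ e)
    (nac : ¬ G.Adj a c) (nad : ¬ G.Adj a d) (nbd : ¬ G.Adj b d) (nbe : ¬ G.Adj b e)
    (nce : ¬ G.Adj c e) : False := by
  have hab' := hab.ne
  have hbc' := hbc.ne
  have hcd' := hcd.ne
  have hde' := hde.ne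
  have hea' := hea.ne
  obtain ⟨i, hi, j, hj, hij, he⟩ :=
    hG a (.cons hab (.cons hbc (.cons hcd (.cons hde (.cons hea .nil)))))
    (by simp [Walk.isCycle_def, Walk.isTrail_def]; grind) (by simp)
  have hij' := hij.symm
  have hne := hij.ne
  simp only [Walk.support_cons, Walk.support_nil, List.mem_cons, List.not_mem_nil, or_false,
    Walk.edges_cons, Walk.edges_nil, not_or,
    Sym2.eq_iff] at hi hj he
  grind

theorem false_of_six_cycle (hG : G.IsChordalGraph) {a b c d e f : V} (hab : G.Adj a b)
    (hbc : G.Adj b c) (hcd : G.Adj c d) (hde : G.Adj d e) (hef : G.Adj e f) (hfa : G.Adj f a)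
    (hac : a ≠ c) (had : a ≠ d) (hae : a ≠ e) (hbd : b ≠ d) (hbe : b ≠ e) (hbf : b ≠ f)
    (hce : c ≠ e) (hcf : c ≠ f) (hdf : d ≠ f)
    (nac : ¬ G.Adj a c) (nad : ¬ G.Adj a d) (nae : ¬ G.Adj a e) (nbd : ¬ G.Adj b d)
    (nbe : ¬ G.Adj b e) (nbf : ¬ G.Adj b f) (nce : ¬ G.Adj c e) (ncf : ¬ G.Adj c f)
    (ndf : ¬ G.Adj d f) : False := by
  have hab' := hab.ne
  have hbc' := hbc.ne
  have hcd' := hcd.ne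
  have hde' := hde.ne
  have hef' := hef.ne
  have hfa' := hfa.ne
  obtain ⟨i, hi, j, hj, hij, he⟩ :=
    hG a (.cons hab (.cons hbc (.cons hcd (.cons hde (.cons hef (.cons hfa .nil))))))
    (by simp [Walk.isCycle_def, Walk.isTrail_def]; grind) (by simp)
  have hij' := hij.symm
  have hne := hij.ne
  simp only [Walk.support_cons, Walk.support_nil, List.mem_cons, List.not_mem_nil, or_false,
    Walk.edges_cons, Walk.edges_nil, not_or,
    Sym2.eq_iff] at hi hj he
  grind

/-- The neighbours of `i` adjacent to a given vertex outside the closed neighbourhood of `i` form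
a clique. -/
theorem adj_of_common_outer (hG : G.IsChordalGraph) {i b w w' : V} (hb : b ≠ i)
    (hib : ¬ G.Adj i b) (hw : G.Adj i w) (hw' : G.Adj i w') (hbw : G.Adj b w)
    (hbw' : G.Adj b w') (hne : w ≠ w') : G.Adj w w' :=
  (hG.adj_of_four_cycle hw hbw.symm hbw' hw'.symm hb.symm hne).resolve_left hib

/-- Otherwise `i, w, b, b', w'` is a chordless 5-cycle or, when `w` and `w'` are adjacent, `w, b,
b', w'` is a chordless 4-cycle. -/
theorem nested_of_adj_outer (hG : G.IsChordalGraph) {i b b' w w' : V} (hb : b ≠ i)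
    (hib : ¬ G.Adj i b) (hb' : b' ≠ i) (hib' : ¬ G.Adj i b') (hbb' : G.Adj b b')
    (hw : G.Adj i w) (hw' : G.Adj i w') (hbw : G.Adj b w) (hbw' : G.Adj b' w') :
    G.Adj b w' ∨ G.Adj b' w := by
  by_contra! hcon
  have hne : w ≠ w' := by rintro rfl; exact hcon.1 hbw
  have h1 : w ≠ b' := by rintro rfl; exact hib' hw
  have h2 : b ≠ w' := by rintro rfl; exact hib hw'
  by_cases hww' : G.Adj w w'
  · rcases hG.adj_of_four_cycle hbw.symm hbb' hbw' hww'.symm h1 h2 with h | h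
    · exact hcon.2 h.symm
    · exact hcon.1 h
  · exact hG.false_of_five_cycle hw hbw.symm hbb' hbw' hw'.symm hb.symm hb'.symm h1 hne h2
      hib hib' (fun h => hcon.2 h.symm) hww' hcon.1

/-- A set of vertices outside the closed neighbourhood of `i` contains an independent set with
the same neighbours among the neighbours of `i`. -/
theorem exists_isIndepSet_dominating [Finite V] (hG : G.IsChordalGraph) (i : V) (B : Set V)
    (hB : ∀ b ∈ B, b ≠ i ∧ ¬ G.Adj i b) :
    ∃ A : Finset V, (A : Set V) ⊆ B ∧ G.IsIndepSet (A : Set V) ∧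
      ∀ w, G.Adj i w → (∃ b ∈ B, G.Adj b w) → ∃ a ∈ A, G.Adj a w := by
  classical
  have := Fintype.ofFinite V
  let dom : Finset V → Finset V := fun A => {w | G.Adj i w ∧ ∃ a ∈ A, G.Adj a w}
  obtain ⟨A, hA, hmax⟩ := Finset.exists_max_image
    (Finset.univ.filter fun A : Finset V => (A : Set V) ⊆ B ∧ G.IsIndepSet (A : Set V))
    (fun A => (dom A).card) ⟨∅, by simp [IsIndepSet]⟩
  rw [Finset.mem_filter] at hA
  obtain ⟨-, hAB, hAi⟩ := hA
  refine ⟨A, hAB, hAi, ?_⟩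
  rintro w hw ⟨b, hb, hbw⟩
  by_contra! hcon
  -- Exchange: `b` replaces its neighbours in `A`. As these miss `w`, nestedness shows that `b`
  -- dominates all that they did, and `w` besides.
  let A' : Finset V := insert b (A.filter fun a => ¬ G.Adj a b)
  have hA' : A' ∈ Finset.univ.filter fun A : Finset V =>
      (A : Set V) ⊆ B ∧ G.IsIndepSet (A : Set V) := by
    rw [Finset.mem_filter]
    refine ⟨Finset.mem_univ _, ?_, ?_⟩
    · intro x hx
      simp only [A', Finset.coe_insert, Set.mem_insert_iff, Finset.mem_coe,
        Finset.mem_filter] at hx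
      rcases hx with rfl | hx
      · exact hb
      · exact hAB hx.1
    · intro x hx y hy hxy
      simp only [A', Finset.coe_insert, Set.mem_insert_iff, Finset.mem_coe,
        Finset.mem_filter] at hx hy
      rcases hx with rfl | hx <;> rcases hy with rfl | hy
      · exact absurd rfl hxy
      · exact fun h => hy.2 h.symm
      · exact hx.2
      · exact hAi hx.1 hy.1 hxy
  have hlt : dom A ⊂ dom A' := by
    rw [Finset.ssubset_iff_of_subset]
    · refine ⟨w, ?_, ?_⟩
      · simp only [dom, Finset.mem_filter, Finset.mem_univ, true_and]
        exact ⟨hw, b, by simp [A'], hbw⟩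
      · simp only [dom, Finset.mem_filter, Finset.mem_univ, true_and, not_and, not_exists]
        exact fun _ a ha => hcon a ha
    · intro w' hw'
      simp only [dom, Finset.mem_filter, Finset.mem_univ, true_and] at hw' ⊢
      obtain ⟨hiw', a, ha, haw'⟩ := hw'
      refine ⟨hiw', ?_⟩
      by_cases hab : G.Adj a b
      · refine ⟨b, by simp [A'], ?_⟩
        have h1 := hB a (hAB ha)
        have h2 := hB b hb
        rcases hG.nested_of_adj_outer h1.1 h1.2 h2.1 h2.2 hab hiw' hw haw' hbw with h | h
        · exact absurd h (hcon a ha)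
        · exact h
      · exact ⟨a, by simp [A', ha, hab], haw'⟩
  exact absurd (hmax A' hA') (not_le.2 (Finset.card_lt_card hlt))

end IsChordalGraph

/-! ### Pendant vertices forced by rigidity -/

section Rigid

variable {K : Type*} [Field K]

theorem IsAlgRigid.exists_outer_of_not_isPendantAt (h : G.IsAlgRigid K) {i w : V}
    (hw : G.Adj i w) (hp : ¬ G.IsPendantAt i w) : ∃ b, b ≠ i ∧ ¬ G.Adj i b ∧ G.Adj b w := by
  have : ∃ u, G.Adj w u ∧ u ≠ i := by
    by_contra! hcon
    exact hp ⟨hw, hcon⟩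
  obtain ⟨u, hu, hui⟩ := this
  -- The criterion is applied with centre `w`, its neighbours `i` and `u`, and the empty independent
  -- set.
  obtain ⟨v, hv1, hv2, hv3, -⟩ := h.exists_not_adj_not_dominated (A := ∅) hw.symm hu hui
    (by simp [IsIndepSet]) (by simp) (by simp) (by simp)
  exact ⟨v, hv2, hv3, hv1.symm⟩

/-- Otherwise an independent `A` of outer vertices not adjacent to `j` also avoids the neighbours of
`x`. Choosing `A` dominating leaves undominated only neighbours of `i` that share an outer neighbour
with `j`, and chordality makes these adjacent to `j`. -/
theorem IsAlgRigid.exists_outer_not_adj [Finite V] (h : G.IsAlgRigid K) (hG : G.IsChordalGraph)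
    {i j x : V} (hp : ∀ l, ¬ G.IsPendantAt i l) (hij : G.Adj i j) (hix : G.Adj i x)
    (hxj : x ≠ j) : ∃ b, b ≠ i ∧ ¬ G.Adj i b ∧ G.Adj b x ∧ ¬ G.Adj b j := by
  by_contra! hcon
  obtain ⟨A, hAB, hA, hdom⟩ := hG.exists_isIndepSet_dominating i
    {b | (b ≠ i ∧ ¬ G.Adj i b) ∧ ¬ G.Adj b j} fun b hb => hb.1
  obtain ⟨v, hiv, hvj, hjv, hvA⟩ := h.exists_not_adj_not_dominated hij hix hxj hA
    (fun a ha hai => (hAB ha).1.2 hai.symm) (fun a ha => (hAB ha).2)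
    (fun a ha hax => (hAB ha).2 (hcon a (hAB ha).1.1 (hAB ha).1.2 hax))
  obtain ⟨b, hbi, hib, hbv⟩ := h.exists_outer_of_not_isPendantAt hiv (hp v)
  by_cases hbj : G.Adj b j
  · exact hjv (hG.adj_of_common_outer hbi hib hij hiv hbj hbv hvj.symm)
  · obtain ⟨a, ha, hav⟩ := hdom v hiv ⟨b, ⟨⟨hbi, hib⟩, hbj⟩, hbv⟩
    exact hvA a ha hav

theorem IsAlgRigid.exists_isPendantAt_of_triangle [Finite V] (h : G.IsAlgRigid K)
    (hG : G.IsChordalGraph) {i j k : V} (hij : G.Adj i j) (hik : G.Adj i k) (hjk : G.Adj j k) :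
    ∃ l, G.IsPendantAt i l := by
  by_contra! hp
  obtain ⟨A, hAB, hA, hdom⟩ := hG.exists_isIndepSet_dominating i
    {b | (b ≠ i ∧ ¬ G.Adj i b) ∧ ¬ G.Adj b j ∧ ¬ G.Adj b k} fun b hb => hb.1
  obtain ⟨v, hiv, hvj, hjv, hvA⟩ := h.exists_not_adj_not_dominated hij hik hjk.ne.symm hA
    (fun a ha hai => (hAB ha).1.2 hai.symm) (fun a ha => (hAB ha).2.1)
    (fun a ha => (hAB ha).2.2)
  have hvk : v ≠ k := by rintro rfl; exact hjv hjk
  -- The outer neighbour of `v` has to avoid `k`, so that only its adjacency to `j` remains to be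
  -- examined.
  obtain ⟨b, hbi, hib, hbv, hbk⟩ := h.exists_outer_not_adj hG hp hik hiv hvk
  by_cases hbj : G.Adj b j
  · exact hjv (hG.adj_of_common_outer hbi hib hij hiv hbj hbv hvj.symm)
  · obtain ⟨a, ha, hav⟩ := hdom v hiv ⟨b, ⟨⟨hbi, hib⟩, hbj, hbk⟩, hbv⟩
    exact hvA a ha hav

theorem IsAlgRigid.exists_isPendantAt_ne [Finite V] (h : G.IsAlgRigid K)
    (hG : G.IsChordalGraph) {i j : V} (hj : G.IsPendantAt i j) :
    ∃ l, l ≠ j ∧ G.IsPendantAt i l := by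
  by_contra! hp
  obtain ⟨A, hAB, hA, hdom⟩ := hG.exists_isIndepSet_dominating i
    {b | b ≠ i ∧ ¬ G.Adj i b} fun b hb => hb
  rcases h.exists_adj_not_dominated hj.1 hA (fun a ha hai => (hAB ha).2 hai.symm)
    (fun a ha haj => (hAB ha).1 (hj.2 a haj.symm)) with ⟨v, hiv, hvj, hvA⟩ | ⟨v, hjv, hvi, -⟩
  · obtain ⟨b, hbi, hib, hbv⟩ := h.exists_outer_of_not_isPendantAt hiv (hp v hvj)
    obtain ⟨a, ha, hav⟩ := hdom v hiv ⟨b, ⟨hbi, hib⟩, hbv⟩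
    exact hvA a ha hav
  · exact hvi (hj.2 v hjv)

/-- An edge `b b'` would close the 6-cycle `i, w, b, b', w', j`; its possible chords are excluded by
the hypotheses or by 4- and 5-cycles. -/
theorem IsChordalGraph.not_adj_of_outer_of_adj (hG : G.IsChordalGraph) {i j w w' b b' : V}
    (hij : G.Adj i j) (hti : ∀ x y, G.Adj i x → G.Adj i y → ¬ G.Adj x y)
    (htj : ∀ x y, G.Adj j x → G.Adj j y → ¬ G.Adj x y) (hw : G.Adj i w) (hwj : w ≠ j)
    (hw' : G.Adj j w') (hwi' : w' ≠ i) (hib : ¬ G.Adj i b) (hjb : ¬ G.Adj j b)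
    (hib' : ¬ G.Adj i b') (hjb' : ¬ G.Adj j b') (hbw : G.Adj b w) (hbw' : G.Adj b' w') :
    ¬ G.Adj b b' := by
  intro hbb'
  have hbi : i ≠ b := by rintro rfl; exact hjb hij.symm
  have hbj : b ≠ j := by rintro rfl; exact hib hij
  have hbi' : i ≠ b' := by rintro rfl; exact hjb' hij.symm
  have hbj' : b' ≠ j := by rintro rfl; exact hib' hij
  have niw' : ¬ G.Adj i w' := fun hh => htj i w' hij.symm hw' hh
  have njw : ¬ G.Adj w j := fun hh => hti w j hw hij hh
  have hww' : w ≠ w' := by rintro rfl; exact niw' hw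
  have nww' : ¬ G.Adj w w' := fun hh => by
    rcases hG.adj_of_four_cycle hw hh hw'.symm hij.symm hwi'.symm hwj with h | h
    · exact niw' h
    · exact njw h
  have hbw'ne : b ≠ w' := by rintro rfl; exact hjb hw'
  have hwb' : w ≠ b' := by rintro rfl; exact hib' hw
  have nbw' : ¬ G.Adj b w' := fun hh =>
    hG.false_of_five_cycle hw hbw.symm hh hw'.symm hij.symm hbi hwi'.symm hww' hwj hbj
      hib niw' nww' njw (fun hh => hjb hh.symm)
  have nwb' : ¬ G.Adj w b' := fun hh =>
    hG.false_of_five_cycle hw hh hbw' hw'.symm hij.symm hbi' hwi'.symm hww' hwj hbj'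
      hib' niw' nww' njw (fun hh => hjb' hh.symm)
  exact hG.false_of_six_cycle hw hbw.symm hbb' hbw' hw'.symm hij.symm hbi hbi' hwi'.symm hwb'
    hww' hwj hbw'ne hbj hbj' hib hib' niw' nwb' nww' njw nbw' (fun hh => hjb hh.symm)
    (fun hh => hjb' hh.symm)

theorem IsChordalGraph.not_adj_of_outer (hG : G.IsChordalGraph) {i w w' b b' : V}
    (hti : ∀ x y, G.Adj i x → G.Adj i y → ¬ G.Adj x y) (hw : G.Adj i w) (hw' : G.Adj i w')
    (hww' : w ≠ w') (hbi : b ≠ i) (hib : ¬ G.Adj i b) (hbi' : b' ≠ i) (hib' : ¬ G.Adj i b')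
    (hbw : G.Adj b w) (hbw' : G.Adj b' w') : ¬ G.Adj b b' := by
  intro hbb'
  rcases hG.nested_of_adj_outer hbi hib hbi' hib' hbb' hw hw' hbw hbw' with h | h
  · exact hti _ _ hw hw' (hG.adj_of_common_outer hbi hib hw hw' hbw h hww')
  · exact hti _ _ hw hw' (hG.adj_of_common_outer hbi' hib' hw hw' h hbw' hww')

/-- If the edge is not a branch, neither end lies in a triangle. Each further neighbour `w` of an
end then has a neighbour `f w` outside both closed neighbourhoods, and the `f w` form an independent
set that isolates the edge. -/
theorem IsAlgRigid.exists_isPendantAt_of_adj [Finite V] (h : G.IsAlgRigid K)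
    (hG : G.IsChordalGraph) {i j : V} (hij : G.Adj i j) :
    (∃ l, l ≠ j ∧ G.IsPendantAt i l) ∨ ∃ l, l ≠ i ∧ G.IsPendantAt j l := by
  classical
  have := Fintype.ofFinite V
  by_contra! hcon
  obtain ⟨hpi, hpj⟩ := hcon
  have hti : ∀ x y, G.Adj i x → G.Adj i y → ¬ G.Adj x y := by
    intro x y hx hy hxy
    obtain ⟨l, hl⟩ := h.exists_isPendantAt_of_triangle hG hx hy hxy
    obtain ⟨l', hl', hp⟩ := h.exists_isPendantAt_ne hG
      (show G.IsPendantAt i j by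
        by_cases hlj : l = j
        · exact hlj ▸ hl
        · exact absurd hl (hpi l hlj))
    exact hpi l' hl' hp
  have htj : ∀ x y, G.Adj j x → G.Adj j y → ¬ G.Adj x y := by
    intro x y hx hy hxy
    obtain ⟨l, hl⟩ := h.exists_isPendantAt_of_triangle hG hx hy hxy
    obtain ⟨l', hl', hp⟩ := h.exists_isPendantAt_ne hG
      (show G.IsPendantAt j i by
        by_cases hlj : l = i
        · exact hlj ▸ hl
        · exact absurd hl (hpj l hlj))
    exact hpj l' hl' hp
  have hex : ∀ w, (G.Adj i w ∧ w ≠ j) ∨ (G.Adj j w ∧ w ≠ i) →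
      ∃ b, (b ≠ i ∧ ¬ G.Adj i b) ∧ (b ≠ j ∧ ¬ G.Adj j b) ∧ G.Adj b w := by
    rintro w (⟨hw, hwj⟩ | ⟨hw, hwi⟩)
    · obtain ⟨b, hbi, hib, hbw⟩ := h.exists_outer_of_not_isPendantAt hw (hpi w hwj)
      refine ⟨b, ⟨hbi, hib⟩, ⟨by rintro rfl; exact hib hij, fun hjb => ?_⟩, hbw⟩
      rcases hG.adj_of_four_cycle hw hbw.symm hjb.symm hij.symm hbi.symm hwj with h' | h'
      · exact hib h'
      · exact hti _ _ hw hij h'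
    · obtain ⟨b, hbj, hjb, hbw⟩ := h.exists_outer_of_not_isPendantAt hw (hpj w hwi)
      refine ⟨b, ⟨by rintro rfl; exact hjb hij.symm, fun hib => ?_⟩, ⟨hbj, hjb⟩, hbw⟩
      rcases hG.adj_of_four_cycle hw hbw.symm hib.symm hij hbj.symm hwi with h' | h'
      · exact hjb h'
      · exact htj _ _ hw hij.symm h'
  choose! f hfi hfj hfw using hex
  let W : Finset V := Finset.univ.filter fun w => (G.Adj i w ∧ w ≠ j) ∨ (G.Adj j w ∧ w ≠ i)
  have hW : ∀ w, w ∈ W ↔ (G.Adj i w ∧ w ≠ j) ∨ (G.Adj j w ∧ w ≠ i) := fun w => by simp [W]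
  have hA : G.IsIndepSet ((W.image f : Finset V) : Set V) := by
    intro x hx y hy hxy
    simp only [Finset.coe_image, Set.mem_image, Finset.mem_coe, hW] at hx hy
    obtain ⟨w, hw, rfl⟩ := hx
    obtain ⟨w', hw', rfl⟩ := hy
    have hne : w ≠ w' := by rintro rfl; exact hxy rfl
    have h1 := hfi w hw
    have h2 := hfj w hw
    have h3 := hfw w hw
    have h1' := hfi w' hw'
    have h2' := hfj w' hw'
    have h3' := hfw w' hw'
    rcases hw with hw | hw <;> rcases hw' with hw' | hw'
    · exact hG.not_adj_of_outer hti hw.1 hw'.1 hne h1.1 h1.2 h1'.1 h1'.2 h3 h3'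
    · exact hG.not_adj_of_outer_of_adj hij hti htj hw.1 hw.2 hw'.1 hw'.2 h1.2 h2.2 h1'.2 h2'.2
        h3 h3'
    · exact hG.not_adj_of_outer_of_adj hij.symm htj hti hw.1 hw.2 hw'.1 hw'.2 h2.2 h1.2 h2'.2
        h1'.2 h3 h3'
    · exact hG.not_adj_of_outer htj hw.1 hw'.1 hne h2.1 h2.2 h2'.1 h2'.2 h3 h3'
  have hmem : ∀ w ∈ W, f w ∈ W.image f := fun w hw => Finset.mem_image_of_mem f hw
  rcases h.exists_adj_not_dominated hij hA
    (fun a ha hai => by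
      obtain ⟨w, hw, rfl⟩ := Finset.mem_image.1 ha
      exact (hfi w ((hW w).1 hw)).2 hai.symm)
    (fun a ha haj => by
      obtain ⟨w, hw, rfl⟩ := Finset.mem_image.1 ha
      exact (hfj w ((hW w).1 hw)).2 haj.symm) with ⟨v, hv, hvj, hvA⟩ | ⟨v, hv, hvi, hvA⟩
  · have hvW := Or.inl (b := G.Adj j v ∧ v ≠ i) (And.intro hv hvj)
    exact hvA _ (hmem v ((hW v).2 hvW)) (hfw v hvW)
  · have hvW := Or.inr (a := G.Adj i v ∧ v ≠ j) (And.intro hv hvi)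
    exact hvA _ (hmem v ((hW v).2 hvW)) (hfw v hvW)

end Rigid

end SimpleGraph

/-! ### Rigidity of graphs with enough leaves -/

namespace SimpleGraph

variable {V : Type*} {G : SimpleGraph V} {K : Type*} [Field K]

open MvPolynomial

/-- The support of the exponent `m` is an independent set. -/
def IsIndepExponent (G : SimpleGraph V) (m : V →₀ ℕ) : Prop :=
  ∀ u v, m u ≠ 0 → m v ≠ 0 → ¬ G.Adj u v

theorem IsIndepExponent.of_le {m n : V →₀ ℕ} (hn : G.IsIndepExponent n) (h : m ≤ n) :
    G.IsIndepExponent m := fun u v hu hv =>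
  hn u v (fun h0 => hu (Nat.le_zero.1 (h0 ▸ h u))) (fun h0 => hv (Nat.le_zero.1 (h0 ▸ h v)))

theorem IsIndepExponent.add_single {m : V →₀ ℕ} (hm : G.IsIndepExponent m) {w : V}
    (hw : ∀ x, G.Adj w x → m x = 0) : G.IsIndepExponent (m + Finsupp.single w 1) := by
  classical
  intro x y hx hy hxy
  by_cases hxw : x = w
  · subst hxw
    rw [Finsupp.add_apply, hw y hxy, Finsupp.single_eq_of_ne hxy.ne.symm] at hy
    exact hy rfl
  by_cases hyw : y = w
  · subst hyw
    rw [Finsupp.add_apply, hw x hxy.symm, Finsupp.single_eq_of_ne hxy.ne] at hx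
    exact hx rfl
  rw [Finsupp.add_apply, Finsupp.single_eq_of_ne hxw, add_zero] at hx
  rw [Finsupp.add_apply, Finsupp.single_eq_of_ne hyw, add_zero] at hy
  exact hm x y hx hy hxy

/-- For a monomial ideal membership is tested monomial by monomial, and the monomials outside are
those with independent support. -/
theorem mem_edgeIdeal_iff {f : MvPolynomial V K} :
    f ∈ G.edgeIdeal K ↔ ∀ m, G.IsIndepExponent m → coeff m f = 0 := by
  classical
  have hI : G.edgeIdeal K = Ideal.span ((fun s => monomial s (1 : K)) ''
      {s | ∃ i j, G.Adj i j ∧ s = Finsupp.single i 1 + Finsupp.single j 1}) := by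
    rw [edgeIdeal]
    congr 1
    ext p
    constructor
    · rintro ⟨i, j, hij, rfl⟩
      exact ⟨_, ⟨i, j, hij, rfl⟩, by simp [X, monomial_mul]⟩
    · rintro ⟨_, ⟨i, j, hij, rfl⟩, rfl⟩
      exact ⟨i, j, hij, by simp [X, monomial_mul]⟩
  rw [hI, mem_ideal_span_monomial_image]
  constructor
  · intro h m hm
    by_contra h0
    obtain ⟨_, ⟨i, j, hij, rfl⟩, hle⟩ := h m (mem_support_iff.2 h0)
    refine hm i j ?_ ?_ hij
    · have := hle i
      simp only [Finsupp.add_apply, Finsupp.single_eq_same] at this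
      omega
    · have := hle j
      simp only [Finsupp.add_apply, Finsupp.single_eq_same] at this
      omega
  · intro h m hm
    by_contra! hcon
    refine mem_support_iff.1 hm (h m fun i j hi hj hij => hcon _ ⟨i, j, hij, rfl⟩ ?_)
    intro w
    by_cases hwi : w = i
    · subst hwi
      rw [Finsupp.add_apply, Finsupp.single_eq_same, Finsupp.single_eq_of_ne hij.ne]
      omega
    · by_cases hwj : w = j
      · subst hwj
        rw [Finsupp.add_apply, Finsupp.single_eq_same, Finsupp.single_eq_of_ne hwi]
        omega
      · simp [Finsupp.single_eq_of_ne hwi, Finsupp.single_eq_of_ne hwj]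

theorem coeff_X_mul_of_eq_zero {v : V} {m : V →₀ ℕ} (h : m v = 0) (p : MvPolynomial V K) :
    coeff m (X v * p) = 0 := by
  classical
  rw [coeff_X_mul', if_neg (by simpa using h)]

theorem coeff_add_single_X_mul (v : V) (m : V →₀ ℕ) (p : MvPolynomial V K) :
    coeff (m + Finsupp.single v 1) (X v * p) = coeff m p := by
  rw [add_comm, coeff_X_mul]

/-- A family `g` of polynomials, indexed by the oriented edges, that defines a homomorphism
`I(G) → S ⧸ I(G)`, `x_u x_v ↦ g u v`. -/
structure IsTangentFamily (G : SimpleGraph V) (g : V → V → MvPolynomial V K) : Prop where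
  symm : ∀ u v, G.Adj u v → g u v - g v u ∈ G.edgeIdeal K
  syzygy : ∀ u v w, G.Adj u v → G.Adj u w → X w * g u v - X v * g u w ∈ G.edgeIdeal K

/-! ### Solving for a derivation coefficient by coefficient -/

namespace IsTangentFamily

variable {g : V → V → MvPolynomial V K}

theorem coeff_symm (hg : G.IsTangentFamily g) {u v : V} (huv : G.Adj u v) {m : V →₀ ℕ}
    (hm : G.IsIndepExponent m) : coeff m (g u v) = coeff m (g v u) := by
  have := mem_edgeIdeal_iff.1 (hg.symm u v huv) m hm
  rwa [coeff_sub, sub_eq_zero] at this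

theorem coeff_syzygy (hg : G.IsTangentFamily g) {u v w : V} (huv : G.Adj u v)
    (huw : G.Adj u w) {m : V →₀ ℕ} (hm : G.IsIndepExponent m) :
    coeff m (X w * g u v) = coeff m (X v * g u w) := by
  have := mem_edgeIdeal_iff.1 (hg.syzygy u v w huv huw) m hm
  rwa [coeff_sub, sub_eq_zero] at this

/-- Multiplying by `x_w` keeps the support independent, and the syzygy turns the coefficient into
one of a multiple of `x_v` at an exponent without `v`. -/
theorem coeff_eq_zero_of_isPendantAt (hg : G.IsTangentFamily g) {u v w : V} (huv : G.Adj u v)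
    (hwv : w ≠ v) (hw : G.IsPendantAt u w) {m : V →₀ ℕ} (hm : G.IsIndepExponent m)
    (hu : m u = 0) (hv : m v = 0) : coeff m (g u v) = 0 := by
  rw [← coeff_add_single_X_mul w, hg.coeff_syzygy huv hw.1
    (hm.add_single fun x hx => by rw [hw.2 x hx, hu])]
  exact coeff_X_mul_of_eq_zero (by simp [hv, Finsupp.single_eq_of_ne hwv.symm]) _

theorem coeff_eq_zero (hg : G.IsTangentFamily g) {u v : V} (huv : G.IsBranch s(u, v))
    {m : V →₀ ℕ} (hm : G.IsIndepExponent m) (hu : m u = 0) (hv : m v = 0) :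
    coeff m (g u v) = 0 := by
  obtain ⟨hadj, ⟨w, hw, hp⟩ | ⟨w, hw, hp⟩⟩ := isBranch_iff.1 huv
  · exact hg.coeff_eq_zero_of_isPendantAt hadj hw hp hm hu hv
  · rw [hg.coeff_symm hadj hm]
    exact hg.coeff_eq_zero_of_isPendantAt hadj.symm hw hp hm hv hu

theorem coeff_add_single_eq_of_not_adj (hg : G.IsTangentFamily g) {u v w : V}
    (huv : G.Adj u v) (huw : G.Adj u w) (hvw : ¬ G.Adj v w) {m : V →₀ ℕ}
    (hv : G.IsIndepExponent (m + Finsupp.single v 1))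
    (hw : G.IsIndepExponent (m + Finsupp.single w 1)) :
    coeff (m + Finsupp.single v 1) (g u v) = coeff (m + Finsupp.single w 1) (g u w) := by
  classical
  have hM : G.IsIndepExponent (m + Finsupp.single v 1 + Finsupp.single w 1) := by
    refine hv.add_single fun x hx => ?_
    have hxv : x ≠ v := by rintro rfl; exact hvw hx.symm
    by_contra h0
    refine hw w x (by simp) ?_ hx
    rw [Finsupp.add_apply, Finsupp.single_eq_of_ne hxv, add_zero] at h0
    rw [Finsupp.add_apply]
    omega
  have h1 := hg.coeff_syzygy huv huw hM
  rw [coeff_add_single_X_mul] at h1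
  rw [h1, add_right_comm, coeff_add_single_X_mul]

theorem coeff_add_single_eq (hg : G.IsTangentFamily g)
    (htri : ∀ i j k, G.Adj i j → G.Adj i k → G.Adj j k → ∃ l, G.IsPendantAt i l) {u v w : V}
    (huv : G.Adj u v) (huw : G.Adj u w) {m : V →₀ ℕ} (hu : m u = 0)
    (hv : G.IsIndepExponent (m + Finsupp.single v 1))
    (hw : G.IsIndepExponent (m + Finsupp.single w 1)) :
    coeff (m + Finsupp.single v 1) (g u v) = coeff (m + Finsupp.single w 1) (g u w) := by
  by_cases hvw : G.Adj v w
  · obtain ⟨l, hl⟩ := htri u v w huv huw hvw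
    have hil : G.IsIndepExponent (m + Finsupp.single l 1) :=
      (hv.of_le le_self_add).add_single fun x hx => by rw [hl.2 x hx, hu]
    rw [hg.coeff_add_single_eq_of_not_adj huv hl.1 (fun h => huv.ne (hl.2 v h.symm).symm) hv hil]
    exact hg.coeff_add_single_eq_of_not_adj hl.1 huw (fun h => huw.ne (hl.2 w h).symm) hil hw
  · exact hg.coeff_add_single_eq_of_not_adj huv huw hvw hv hw

theorem exists_coeff_eq [Finite V] (hg : G.IsTangentFamily g)
    (htri : ∀ i j k, G.Adj i j → G.Adj i k → G.Adj j k → ∃ l, G.IsPendantAt i l) (u : V) :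
    ∃ d : MvPolynomial V K, ∀ v, G.Adj u v → ∀ m : V →₀ ℕ, m u = 0 →
      G.IsIndepExponent (m + Finsupp.single v 1) →
      coeff m d = coeff (m + Finsupp.single v 1) (g u v) := by
  classical
  have := Fintype.ofFinite V
  have hc : ∀ m : V →₀ ℕ, ∃ c : K,
      (∀ v, G.Adj u v → m u = 0 → G.IsIndepExponent (m + Finsupp.single v 1) →
        c = coeff (m + Finsupp.single v 1) (g u v)) ∧
      (c ≠ 0 → ∃ v, coeff (m + Finsupp.single v 1) (g u v) ≠ 0) := by
    intro m
    by_cases h : ∃ v, G.Adj u v ∧ m u = 0 ∧ G.IsIndepExponent (m + Finsupp.single v 1)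
    · obtain ⟨v, huv, hu, hv⟩ := h
      exact ⟨_, fun w huw _ hw => hg.coeff_add_single_eq htri huv huw hu hv hw, fun h => ⟨v, h⟩⟩
    · exact ⟨0, fun v huv hu hv => absurd ⟨v, huv, hu, hv⟩ h, fun h => absurd rfl h⟩
  choose c hc1 hc2 using hc
  -- A finite set containing every exponent with nonzero prescribed coefficient, so that `d` is a
  -- polynomial.
  let F : Finset (V →₀ ℕ) := Finset.univ.biUnion fun v =>
    (g u v).support.image fun n => n - Finsupp.single v 1
  have hF : ∀ m, c m ≠ 0 → m ∈ F := by
    intro m hm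
    obtain ⟨v, hv⟩ := hc2 m hm
    refine Finset.mem_biUnion.2 ⟨v, Finset.mem_univ _, Finset.mem_image.2
      ⟨_, mem_support_iff.2 hv, add_tsub_cancel_right _ _⟩⟩
  refine ⟨∑ m ∈ F, monomial m (c m), fun v huv m hu hv => ?_⟩
  rw [← hc1 m v huv hu hv, coeff_sum]
  simp only [coeff_monomial]
  rw [Finset.sum_ite_eq' F m c]
  split_ifs with hm
  · rfl
  · by_contra h0
    exact hm (hF m (Ne.symm h0))

theorem exists_derivation_coeff [Finite V] (hg : G.IsTangentFamily g)
    (hbr : ∀ e ∈ G.edgeSet, G.IsBranch e)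
    (htri : ∀ i j k, G.Adj i j → G.Adj i k → G.Adj j k → ∃ l, G.IsPendantAt i l) :
    ∃ d : V → MvPolynomial V K, ∀ u v, G.Adj u v →
      X u * d v + X v * d u - g u v ∈ G.edgeIdeal K := by
  choose d hd using hg.exists_coeff_eq htri
  refine ⟨d, fun u v huv => mem_edgeIdeal_iff.2 fun m hm => ?_⟩
  have key : ∀ a b, G.Adj a b → m b ≠ 0 → coeff m (X b * d a) = coeff m (g a b) := by
    intro a b hab hb
    have ha : m a = 0 := by
      by_contra ha
      exact hm a b ha hb hab
    have hle : Finsupp.single b 1 ≤ m := by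
      rw [Finsupp.single_le_iff]
      omega
    obtain ⟨n, rfl⟩ : ∃ n, m = n + Finsupp.single b 1 := ⟨_, (tsub_add_cancel_of_le hle).symm⟩
    rw [coeff_add_single_X_mul]
    refine hd a b hab n ?_ hm
    rw [Finsupp.add_apply] at ha
    omega
  rw [coeff_sub, coeff_add]
  by_cases hu : m u = 0
  · rw [coeff_X_mul_of_eq_zero hu]
    by_cases hv : m v = 0
    · rw [coeff_X_mul_of_eq_zero hv, hg.coeff_eq_zero (hbr _ huv) hm hu hv]
      simp
    · rw [key u v huv hv]
      simp
  · have hv : m v = 0 := by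
      by_contra hv
      exact hm u v hu hv huv
    rw [coeff_X_mul_of_eq_zero hv, key v u huv.symm hu, hg.coeff_symm huv hm]
    simp

end IsTangentFamily

-- The lifts of the generators form a tangent family; the derivation with values `d` agrees with it
-- on generators modulo the ideal, and the Leibniz rule extends this to the whole ideal.
open TrivSqZeroExt (inl inr) in
theorem isAlgRigid_of_isBranch [Finite V] (hbr : ∀ e ∈ G.edgeSet, G.IsBranch e)
    (htri : ∀ i j k, G.Adj i j → G.Adj i k → G.Adj j k → ∃ l, G.IsPendantAt i l) :
    G.IsAlgRigid K := by
  rw [IsAlgRigid, stanleyReisnerIdeal_independenceComplex]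
  intro J hJ
  have hex : ∀ u v, ∃ g : MvPolynomial V K, G.Adj u v →
      (inl (X u * X v) + inr g : (MvPolynomial V K)[ε]) ∈ J := by
    intro u v
    by_cases huv : G.Adj u v
    · obtain ⟨g, hg⟩ := hJ.exists_lift (X_mul_X_mem_edgeIdeal huv)
      exact ⟨g, fun _ => hg⟩
    · exact ⟨0, fun h => absurd h huv⟩
  choose g hg using hex
  have hfam : G.IsTangentFamily g := by
    constructor
    · intro u v huv
      rw [← hJ.inr_mem_iff]
      convert J.sub_mem (hg u v huv) (hg v u huv.symm) using 1
      rw [mul_comm (X v)]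
      ext <;> simp
    · intro u v w huv huw
      rw [← hJ.inr_mem_iff]
      convert J.sub_mem (J.mul_mem_left (inl (X w)) (hg u v huv))
        (J.mul_mem_left (inl (X v)) (hg u w huw)) using 1
      apply TrivSqZeroExt.ext
      · simp only [TrivSqZeroExt.fst_inr, TrivSqZeroExt.fst_sub, TrivSqZeroExt.fst_mul,
          TrivSqZeroExt.fst_add, TrivSqZeroExt.fst_inl]
        ring
      · simp only [TrivSqZeroExt.snd_inr, TrivSqZeroExt.snd_sub, DualNumber.snd_mul,
          TrivSqZeroExt.fst_add, TrivSqZeroExt.fst_inl, TrivSqZeroExt.snd_add,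
          TrivSqZeroExt.snd_inl]
        ring
  obtain ⟨d, hd⟩ := hfam.exists_derivation_coeff hbr htri
  refine hJ.isTrivialDeformation_of_derivation (mkDerivation K d) fun f hf => ?_
  have hspan : f ∈ Ideal.span {m : MvPolynomial V K | ∃ i j, G.Adj i j ∧ m = X i * X j} := hf
  clear hf
  induction hspan using Submodule.span_induction with
  | mem e he =>
    obtain ⟨u, v, huv, rfl⟩ := he
    convert J.add_mem (hg u v huv) (hJ.inr_mem_iff.2 (hd u v huv)) using 1
    ext <;> simp
  | zero => simp
  | add x y _ _ hx hy =>
    convert J.add_mem hx hy using 1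
    ext <;> simp
  | smul a x hxI hx =>
    convert J.add_mem (J.mul_mem_left (inl a) hx)
      (hJ.inr_mem_iff.2 (Ideal.mul_mem_left _ (mkDerivation K d a) hxI)) using 1
    ext <;> simp [mul_comm]

end SimpleGraph

end

theorem mainTheorem9 {V : Type*} [Finite V] (G : SimpleGraph V) (hG : G.IsChordalGraph)
    (K : Type*) [Field K] :
    G.IsAlgRigid K ↔
      (∀ e ∈ G.edgeSet, G.IsBranch e) ∧
        (∀ v : V, G.IsVertexOfThreeCycle v → ∃ e, G.IsLeafEdge e ∧ v ∈ e) := by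
  constructor
  · intro h
    refine ⟨fun e => ?_, fun v hv => ?_⟩
    · induction e using Sym2.ind with
      | _ i j =>
        exact fun hij => SimpleGraph.isBranch_iff.2 ⟨hij, h.exists_isPendantAt_of_adj hG hij⟩
    · obtain ⟨j, k, hj, hk, hjk⟩ := SimpleGraph.isVertexOfThreeCycle_iff.1 hv
      exact (SimpleGraph.exists_isLeafEdge_iff hj hk hjk.ne).2
        (h.exists_isPendantAt_of_triangle hG hj hk hjk)
  · rintro ⟨hbr, htri⟩
    refine SimpleGraph.isAlgRigid_of_isBranch hbr fun i j k hij hik hjk => ?_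
    exact (SimpleGraph.exists_isLeafEdge_iff hij hik hjk.ne).1
      (htri i (SimpleGraph.isVertexOfThreeCycle_iff.2 ⟨j, k, hij, hik, hjk⟩))
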